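/- Let $A\in\mathbb R^{n_x\times n_x}$, $B\in\mathbb R^{n_x\times n_u}$, $C\in\mathbb R^{n_y\times n_x}$, $D\in\mathbb R^{n_y\times n_u}$, and consider the LTI system $$x_{t+1}=Ax_t+Bu_t,\qquad y_t=Cx_t+Du_t ,$$ assumed controllable (every state can be steered to every other state in finite time). Its external signal is $w_t=(u_t,y_t)\in\mathbb R^{n_u+n_y}$. Its behavior is the set of all sequences $(w_t)_{t\ge 0}$ that satisfy the equations for some state sequence with free initial state, and its length-$L$ external behavior $\mathcal B_L\subseteq\mathcal W_L:=(\mathbb R^{n_u+n_y})^L$ is the set of all $(w_0,\dots,w_{L-1})$ that satisfy the equations for $t=0,\dots,L-1$ with some states $x_0,\dots,x_L$. A realization of the system is any state-space system with the same behavior (it need not be controllable), and the McMillan degree $n$ is the smallest state dimension of a realization. For a finite signal $v=(v_0,\dots,v_{N-1})$ let $H_K(v)$ denote the block Hankel matrix whose columns are the windows $(v_j,\dots,v_{j+K-1})$, $j=0,\dots,N-K$ (no columns if $K>N$; then $\mathbb R^{N-K+1}$ is read as $\mathbb R^0$); an input $u=(u_0,\dots,u_{N-1})$ in $\mathbb R^{n_u}$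 is persistently exciting of order $K$ if $H_K(u)$ has full row rank $Kn_u$. Let $w^d=(u^d,y^d)$ be a noise-free trajectory of length $N$ of the system, that is, $w^d\in\mathcal B_N$. Suppose that $u^d$ is persistently exciting of order $L+n$ or, more generally, of order $L+\bar n$ for some integer $\bar n\ge n$. Then $$\{\mu \text{ Borel probability measure on } \mathcal W_L:\ \mu(\mathcal B_L)=1\}=\{(H_L(w^d))_{\#}\nu:\ \nu \text{ Borel probability measure on } \mathbb R^{N-L+1}\},$$ where $(H_L(w^d))_{\#}\nu$ is the pushforward of $\nu$ under $g\mapsto H_L(w^d)g$. Moreover, the state dimension of every realization of the system, in particular $n_x$, is an upper bound of $n$ and may therefore be taken as $\bar n$. -/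

import Mathlib

open MeasureTheory

/-- A discrete-time LTI system `x (t+1) = A x t + B u t`, `y t = C x t + D u t` with `nx` states,
`nu` inputs and `ny` outputs. -/
structure LTISystem (nx nu ny : ℕ) where
  A : Matrix (Fin nx) (Fin nx) ℝ
  B : Matrix (Fin nx) (Fin nu) ℝ
  C : Matrix (Fin ny) (Fin nx) ℝ
  D : Matrix (Fin ny) (Fin nu) ℝ

/-- The index set of the coordinates of an external signal value `w = (u, y) ∈ ℝ^(nu + ny)`. -/
abbrev ExtIdx (nu ny : ℕ) : Type := Fin nu ⊕ Fin ny

/-- The space `(ℝ^q)^L` of `ℝ^q`-valued signals of length `L`, the coordinates of `ℝ^q` being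
indexed by `ι`. -/
abbrev Signal (L : ℕ) (ι : Type) : Type := Fin L → ι → ℝ

/-- The input component of an external signal value. -/
def inputPart {nu ny : ℕ} (w : ExtIdx nu ny → ℝ) : Fin nu → ℝ := fun i => w (Sum.inl i)

/-- The output component of an external signal value. -/
def outputPart {nu ny : ℕ} (w : ExtIdx nu ny → ℝ) : Fin ny → ℝ := fun i => w (Sum.inr i)

namespace LTISystem

variable {nx nu ny : ℕ}

/-- One time step: with state `x` and external signal value `w = (u, y)`, the next state is `x'`. -/
def Step (S : LTISystem nx nu ny) (x : Fin nx → ℝ) (w : ExtIdx nu ny → ℝ) (x' : Fin nx → ℝ) :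
    Prop :=
  x' = S.A.mulVec x + S.B.mulVec (inputPart w) ∧
    outputPart w = S.C.mulVec x + S.D.mulVec (inputPart w)

/-- The external behavior on the horizon `0, …, L-1`: all input/output trajectories of length `L`
that are compatible with the system equations for some state trajectory (free initial state). -/
def finiteBehavior (S : LTISystem nx nu ny) (L : ℕ) : Set (Signal L (ExtIdx nu ny)) :=
  {w | ∃ x : Fin (L + 1) → Fin nx → ℝ, ∀ t : Fin L, S.Step (x t.castSucc) (w t) (x t.succ)}

/-- The external behavior on the infinite time axis `ℕ` (free initial state). -/
def behavior (S : LTISystem nx nu ny) : Set (ℕ → ExtIdx nu ny → ℝ) :=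
  {w | ∃ x : ℕ → Fin nx → ℝ, ∀ t : ℕ, S.Step (x t) (w t) (x (t + 1))}

/-- Controllability: every state can be steered to every other state in finite time. -/
def Controllable (S : LTISystem nx nu ny) : Prop :=
  ∀ x₀ x₁ : Fin nx → ℝ, ∃ (T : ℕ) (u : ℕ → Fin nu → ℝ) (x : ℕ → Fin nx → ℝ),
    x 0 = x₀ ∧ x T = x₁ ∧ ∀ t < T, x (t + 1) = S.A.mulVec (x t) + S.B.mulVec (u t)

/-- `S'` realizes the system `S`: both have the same external behavior. -/
def Realizes {mx : ℕ} (S' : LTISystem mx nu ny) (S : LTISystem nx nu ny) : Prop :=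
  S'.behavior = S.behavior

/-- The McMillan degree: the smallest state dimension among all realizations of the system. -/
noncomputable def mcMillanDegree (S : LTISystem nx nu ny) : ℕ :=
  sInf {m : ℕ | ∃ S' : LTISystem m nu ny, S'.Realizes S}

/-- The external behavioral-measure set: the Borel probability measures on the space of external
trajectories of length `L` that are supported on the behavior. -/
def behavioralMeasures (S : LTISystem nx nu ny) (L : ℕ) :
    Set (Measure (Signal L (ExtIdx nu ny))) :=
  {μ | IsProbabilityMeasure μ ∧ μ (S.finiteBehavior L) = 1}

end LTISystem

/-- The block Hankel matrix of depth `L` of a signal `w 0, …, w (N-1)`: column `j` is the window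
`w j, …, w (j+L-1)`. It has `N - L + 1` columns if `L ≤ N`, and no column if `L > N`. -/
def hankel {N : ℕ} {ι : Type} (L : ℕ) (w : Signal N ι) :
    Matrix (Fin L × ι) (Fin (N + 1 - L)) ℝ :=
  Matrix.of fun p j => w ⟨p.1.val + j.val, by have := p.1.isLt; have := j.isLt; omega⟩ p.2

/-- The linear map `g ↦ H_L(w) g` from coefficient space to the space of signals of length `L`. -/
def hankelMap {N : ℕ} {ι : Type} (L : ℕ) (w : Signal N ι) (g : Fin (N + 1 - L) → ℝ) :
    Signal L ι :=
  fun t i => (hankel L w).mulVec g (t, i)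

/-- Persistency of excitation of order `K`: the Hankel matrix of depth `K` has full row rank. -/
def PersistentlyExciting {N m : ℕ} (u : Signal N (Fin m)) (K : ℕ) : Prop :=
  (hankel K u).rank = K * m

/-! The core is Willems' fundamental lemma: the behavior of length `L` is the range of the Hankel
map. The measure statement follows from it by pushing `μ` forward along a linear section of that
map.

For the lemma, states are taken modulo the unobservable subspace `ker S.freeResponse`. The quotient
has dimension at most the McMillan degree, inherits reachability, and a state class together with
the inputs determines the outputs. It remains to show that the data columns (state class, input
window) span everything (`exists_hankel_combination`). By duality, let `(ξ, η)` annihilate all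
columns. Shifting this relation along the data and combining the shifts with the coefficients of a
monic polynomial annihilating the state map eliminates the state. What is left is a functional on
input windows of length `L + n`, which persistency of excitation forces to vanish. Its coefficients
give a monic recurrence for the `markovFunctional` sequence, hence `η = 0` and `ξ aⁱ b = 0` for all
`i`, and reachability gives `ξ = 0`. -/

theorem persistentlyExciting_eq_zero {N m K : ℕ} {u : Signal N (Fin m)}
    (hu : PersistentlyExciting u K) (θ : Fin K × Fin m → ℝ)
    (hθ : ∀ j, ∑ p, θ p * hankel K u p j = 0) : θ = 0 := by
  have hli : LinearIndependent ℝ (hankel K u).row := by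
    rw [linearIndependent_iff_card_eq_finrank_span, Set.finrank,
      ← Matrix.rank_eq_finrank_span_row, show (hankel K u).rank = K * m from hu]
    simp
  funext p
  refine Fintype.linearIndependent_iff.1 hli θ ?_ p
  funext j
  simpa [Finset.sum_apply, Matrix.row] using hθ j

/-! ### Duality argument: state classes and input windows of the data span -/

/-- The sequence of Markov-type functionals `η (L-1), …, η 0, ξ b, ξ a b, ξ a² b, …`. -/
noncomputable def markovFunctional {X U : Type*} [AddCommGroup X] [Module ℝ X] [AddCommGroup U]
    [Module ℝ U] (a : Module.End ℝ X) (b : U →ₗ[ℝ] X) (ξ : X →ₗ[ℝ] ℝ) (L : ℕ)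
    (η : ℕ → U →ₗ[ℝ] ℝ) (r : ℕ) : U →ₗ[ℝ] ℝ :=
  if r < L then η (L - 1 - r) else ξ ∘ₗ (a ^ (r - L)) ∘ₗ b

section Shift

open Finset

variable {X U : Type*} [AddCommGroup X] [Module ℝ X] [AddCommGroup U] [Module ℝ U]
  (a : Module.End ℝ X) (b : U →ₗ[ℝ] X) (ξ : X →ₗ[ℝ] ℝ) (L : ℕ) (η : ℕ → U →ₗ[ℝ] ℝ)

/-- Unrolling the state equation `k` times turns the relation at time `j + k` into one in `x j` and
a longer input window. Reversed indexing lets one sequence supply the coefficients for every `k`. -/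
theorem markovFunctional_shift {N : ℕ} {u : ℕ → U} {x : ℕ → X}
    (hx : ∀ t < N, x (t + 1) = a (x t) + b (u t)) (k : ℕ) :
    ∀ j, j + k ≤ N →
      ξ ((a ^ k) (x j)) + ∑ l ∈ range (L + k),
        markovFunctional a b ξ L η (L + k - 1 - l) (u (j + l)) =
      ξ (x (j + k)) + ∑ l ∈ range L, η l (u (j + k + l)) := by
  induction k with
  | zero =>
    intro j _
    simp only [pow_zero, Module.End.one_apply, add_zero]
    congr 1
    refine sum_congr rfl fun l hl => ?_
    have hl := mem_range.1 hl
    rw [markovFunctional, if_pos (by omega), show L - 1 - (L - 1 - l) = l by omega]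
  | succ k ih =>
    intro j hj
    have h := ih (j + 1) (by omega)
    rw [show j + (k + 1) = j + 1 + k by omega, ← h, hx j (by omega), ← add_assoc L k 1,
      sum_range_succ']
    have e : markovFunctional a b ξ L η (L + k + 1 - 1 - 0) (u (j + 0)) =
        ξ ((a ^ k) (b (u j))) := by
      simp [markovFunctional]
    rw [e, map_add, map_add, pow_succ, Module.End.mul_apply]
    have e2 : ∀ l, markovFunctional a b ξ L η (L + k + 1 - 1 - (l + 1)) (u (j + (l + 1))) =
        markovFunctional a b ξ L η (L + k - 1 - l) (u (j + 1 + l)) := fun l => by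
      rw [show L + k + 1 - 1 - (l + 1) = L + k - 1 - l by omega,
        show j + (l + 1) = j + 1 + l by omega]
    simp only [e2]
    ring

/-- A sequence satisfying a monic linear recurrence with zero initial data vanishes. -/
theorem eq_zero_of_monic_recurrence {M : Type*} [AddCommGroup M] [Module ℝ M] {c : ℕ → M} {n : ℕ}
    {α : ℕ → ℝ} (hα : α n = 1)
    (h : ∀ r, ∑ k ∈ range (n + 1), (if n ≤ k + r then α k • c (k + r - n) else 0) = 0) (r : ℕ) :
    c r = 0 := by
  induction r using Nat.strong_induction_on with
  | _ r ih =>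
    have h := h r
    rw [sum_range_succ, if_pos (by omega), hα, one_smul, sum_eq_zero, zero_add] at h
    · simpa using h
    · intro k hk
      have hk := mem_range.1 hk
      split_ifs with h'
      · rw [ih _ (by omega), smul_zero]
      · rfl

theorem markovFunctional_eq_zero {N m : ℕ} (b : (Fin m → ℝ) →ₗ[ℝ] X)
    (η : ℕ → (Fin m → ℝ) →ₗ[ℝ] ℝ) {u : ℕ → Fin m → ℝ} {x : ℕ → X}
    (hx : ∀ t < N, x (t + 1) = a (x t) + b (u t)) {p : Polynomial ℝ} (hp : p.Monic)
    (hpa : Polynomial.aeval a p = 0)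
    (hu : PersistentlyExciting (fun t : Fin N => u t) (L + p.natDegree))
    (h0 : ∀ j < N + 1 - L, ξ (x j) + ∑ l ∈ range L, η l (u (j + l)) = 0) (r : ℕ) :
    markovFunctional a b ξ L η r = 0 := by
  set n := p.natDegree
  set c := markovFunctional a b ξ L η with hc
  have hsum : ∑ k ∈ range (n + 1), p.coeff k • a ^ k = 0 := by
    rw [← hpa, Polynomial.aeval_eq_sum_range]
  refine eq_zero_of_monic_recurrence (n := n) (α := p.coeff) hp (fun r => ?_) r
  by_cases hr : r < L + n
  -- The `p`-weighted sum of the shifted relations: the state term drops out since `p(a) = 0`. Its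
  -- coefficient at `l` is the recurrence sum for `r = L + n - 1 - l`.
  · let θ : ℕ → (Fin m → ℝ) →ₗ[ℝ] ℝ := fun l =>
      ∑ k ∈ range (n + 1), if l < L + k then p.coeff k • c (L + k - 1 - l) else 0
    have hθ : ∀ j < N + 1 - (L + n), ∑ l ∈ range (L + n), θ l (u (j + l)) = 0 := by
      intro j hj
      have h1 : ∀ k ∈ range (n + 1), p.coeff k * (ξ ((a ^ k) (x j)) +
          ∑ l ∈ range (L + k), c (L + k - 1 - l) (u (j + l))) = 0 := fun k hk => by
        have hk := mem_range.1 hk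
        rw [hc, markovFunctional_shift a b ξ L η hx k j (by omega), h0 _ (by omega), mul_zero]
      have h2 := sum_eq_zero h1
      simp only [mul_add, sum_add_distrib] at h2
      have h3 : ∑ k ∈ range (n + 1), p.coeff k * ξ ((a ^ k) (x j)) = 0 := by
        have := congrArg (fun f : Module.End ℝ X => ξ (f (x j))) hsum
        simpa [LinearMap.sum_apply] using this
      rw [h3, zero_add] at h2
      rw [← h2]
      simp only [θ, LinearMap.sum_apply]
      rw [sum_comm]
      refine sum_congr rfl fun k hk => ?_
      have hk := mem_range.1 hk
      rw [mul_sum]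
      symm
      apply sum_subset_zero_on_sdiff (range_subset_range.2 (by omega))
      · intro l hl
        simp only [mem_sdiff, mem_range] at hl
        rw [if_neg hl.2, LinearMap.zero_apply]
      · intro l hl
        rw [if_pos (mem_range.1 hl), LinearMap.smul_apply, smul_eq_mul]
    have hz := persistentlyExciting_eq_zero hu
      (fun q => θ q.1 (Pi.single q.2 1)) (fun j => by
        rw [← hθ j j.isLt, Fintype.sum_prod_type, Finset.sum_range]
        refine sum_congr rfl fun l _ => ?_
        rw [LinearMap.pi_apply_eq_sum_univ (θ l)]
        refine sum_congr rfl fun i _ => ?_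
        simp only [hankel, Matrix.of_apply, smul_eq_mul, add_comm (l : ℕ) (j : ℕ)]
        rw [mul_comm]
        congr 3
        funext i'
        simp [Pi.single_apply, eq_comm])
    have hθ0 : θ (L + n - 1 - r) = 0 := by
      refine LinearMap.pi_ext' fun i => LinearMap.ext_ring ?_
      simpa using congrFun hz (⟨L + n - 1 - r, by omega⟩, i)
    refine Eq.trans (sum_congr rfl fun k hk => ?_) hθ0
    have hk := mem_range.1 hk
    by_cases h : n ≤ k + r
    · rw [if_pos h, if_pos (by omega),
        show L + k - 1 - (L + n - 1 - r) = k + r - n by omega]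
    · rw [if_neg h, if_neg (by omega)]
  -- For `r ≥ L + n` only the terms `ξ aⁱ b` occur, and the recurrence is `p(a) = 0` itself.
  · ext1 i
    have := congrArg (fun f : Module.End ℝ X => ξ ∘ₗ (f * a ^ (r - n - L)) ∘ₗ b) hsum
    simp only [Finset.sum_mul] at this
    have hk : ∀ k, (if n ≤ k + r then p.coeff k • c (k + r - n) else 0) =
        p.coeff k • ξ ∘ₗ (a ^ k * a ^ (r - n - L)) ∘ₗ b := fun k => by
      rw [if_pos (by omega), hc, markovFunctional, if_neg (by omega), ← pow_add,
        show k + r - n - L = k + (r - n - L) by omega]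
    simp only [hk]
    ext
    have := congrFun (congrArg DFunLike.coe this) (Pi.single i 1)
    simpa [LinearMap.sum_apply] using this

/-- For a persistently exciting input, the initial state and the input window of linear
combinations of data windows are arbitrary. -/
theorem exists_hankel_combination [Module.Finite ℝ X] {N m : ℕ} (b : (Fin m → ℝ) →ₗ[ℝ] X)
    (hreach : ∀ ξ : X →ₗ[ℝ] ℝ, (∀ i, ξ ∘ₗ (a ^ i) ∘ₗ b = 0) → ξ = 0)
    {u : ℕ → Fin m → ℝ} {x : ℕ → X}
    (hx : ∀ t < N, x (t + 1) = a (x t) + b (u t)) {n : ℕ} (hn : Module.finrank ℝ X ≤ n)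
    (hu : PersistentlyExciting (fun t : Fin N => u t) (L + n)) (x₀ : X) (v : Signal L (Fin m)) :
    ∃ g : Fin (N + 1 - L) → ℝ, ∑ j, g j • x j = x₀ ∧
      ∀ l : Fin L, ∑ j, g j • u (j + l) = v l := by
  let Ψ : (Fin (N + 1 - L) → ℝ) →ₗ[ℝ] X × Signal L (Fin m) :=
    Fintype.linearCombination ℝ fun j : Fin (N + 1 - L) =>
      ((x j, fun l => u (j + l)) : X × Signal L (Fin m))
  suffices h : LinearMap.range Ψ = ⊤ by
    obtain ⟨g, hg⟩ := LinearMap.range_eq_top.1 h (x₀, v)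
    rw [Fintype.linearCombination_apply] at hg
    refine ⟨g, ?_, fun l => ?_⟩
    · simpa [Prod.fst_sum] using congrArg Prod.fst hg
    · simpa [Prod.snd_sum, Finset.sum_apply] using congrFun (congrArg Prod.snd hg) l
  by_contra hlt
  obtain ⟨f, hf, hle⟩ := Submodule.exists_le_ker_of_lt_top _ (lt_top_iff_ne_top.2 hlt)
  let ξ : X →ₗ[ℝ] ℝ := f ∘ₗ LinearMap.inl ℝ X (Signal L (Fin m))
  let η : ℕ → (Fin m → ℝ) →ₗ[ℝ] ℝ := fun l =>
    if h : l < L then f ∘ₗ LinearMap.inr ℝ X (Signal L (Fin m)) ∘ₗ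
      LinearMap.single ℝ (fun _ : Fin L => Fin m → ℝ) ⟨l, h⟩
    else 0
  have hη : ∀ l : Fin L, η l =
      f ∘ₗ LinearMap.inr ℝ X (Signal L (Fin m)) ∘ₗ LinearMap.single ℝ _ l := fun l => by
    simp [η]
  have hf_eq : ∀ z w, f (z, w) = ξ z + ∑ l : Fin L, η l (w l) := by
    intro z w
    have e1 : ((z, w) : X × Signal L (Fin m)) = LinearMap.inl ℝ X _ z + LinearMap.inr ℝ X _ w := by
      simp
    have e2 : w = ∑ l : Fin L, LinearMap.single ℝ (fun _ : Fin L => Fin m → ℝ) l (w l) := by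
      simp [Finset.univ_sum_single]
    rw [e1, map_add]
    congr 1
    conv_lhs => rw [e2]
    simp only [map_sum, hη, LinearMap.comp_apply]
  have h0 : ∀ j < N + 1 - L, ξ (x j) + ∑ l ∈ range L, η l (u (j + l)) = 0 := by
    intro j hj
    rw [Finset.sum_range, ← hf_eq (x j) fun l => u (j + l)]
    refine hle ⟨Pi.single (⟨j, hj⟩ : Fin (N + 1 - L)) 1, ?_⟩
    simp [Ψ, Fintype.linearCombination_apply_single]
  -- The power of `X` raises the degree to exactly `n`, which is how an upper bound on the dimension
  -- suffices.
  let p : Polynomial ℝ := LinearMap.charpoly a * Polynomial.X ^ (n - Module.finrank ℝ X)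
  have hpm : p.Monic := (LinearMap.charpoly_monic a).mul (Polynomial.monic_X_pow _)
  have hpd : p.natDegree = n := by
    rw [(LinearMap.charpoly_monic a).natDegree_mul (Polynomial.monic_X_pow _),
      LinearMap.charpoly_natDegree, Polynomial.natDegree_X_pow]
    omega
  have hpa : Polynomial.aeval a p = 0 := by
    rw [map_mul, LinearMap.aeval_self_charpoly, zero_mul]
  have hc := markovFunctional_eq_zero a ξ L b η hx hpm hpa (by rwa [hpd]) h0
  have hξ : ξ = 0 := hreach ξ fun i => by
    simpa [markovFunctional] using hc (L + i)
  have hη0 : ∀ l : Fin L, η l = 0 := fun l => by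
    have := hc (L - 1 - l)
    rwa [markovFunctional, if_pos (by omega), show L - 1 - (L - 1 - (l : ℕ)) = l by omega] at this
  apply hf
  refine LinearMap.ext fun ⟨z, w⟩ => ?_
  rw [hf_eq, hξ]
  simp [hη0]

end Shift

/-! ### Free responses, McMillan degree and reachability -/

namespace LTISystem

variable {nx nu ny : ℕ}

/-- The free response `t ↦ C Aᵗ x` as a linear function of the initial state. -/
noncomputable def freeResponse (S : LTISystem nx nu ny) :
    (Fin nx → ℝ) →ₗ[ℝ] (ℕ → Fin ny → ℝ) :=
  LinearMap.pi fun t => S.C.mulVecLin ∘ₗ (S.A.mulVecLin ^ t)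

theorem freeResponse_apply (S : LTISystem nx nu ny) (x : Fin nx → ℝ) (t : ℕ) :
    S.freeResponse x t = S.C.mulVec ((S.A.mulVecLin ^ t) x) := rfl

/-- Zero-input trajectories depend on the behavior alone, so all realizations share the same space
of free responses. -/
theorem mem_range_freeResponse (S : LTISystem nx nu ny) (y : ℕ → Fin ny → ℝ) :
    y ∈ LinearMap.range S.freeResponse ↔
      (fun t => (Sum.elim 0 (y t) : ExtIdx nu ny → ℝ)) ∈ S.behavior := by
  have hin : ∀ z, inputPart (Sum.elim 0 z : ExtIdx nu ny → ℝ) = 0 := fun z => rfl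
  have hout : ∀ z, outputPart (Sum.elim 0 z : ExtIdx nu ny → ℝ) = z := fun z => rfl
  constructor
  · rintro ⟨x, rfl⟩
    refine ⟨fun t => (S.A.mulVecLin ^ t) x, fun t => ⟨?_, ?_⟩⟩
    · beta_reduce
      rw [hin, Matrix.mulVec_zero, add_zero, pow_succ', Module.End.mul_apply,
        Matrix.mulVecLin_apply]
    · rw [hin, hout, Matrix.mulVec_zero, add_zero, freeResponse_apply]
  · rintro ⟨x, hx⟩
    have hxt : ∀ t, x t = (S.A.mulVecLin ^ t) (x 0) := by
      intro t
      induction t with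
      | zero => simp
      | succ t ih =>
        rw [(hx t).1, hin, Matrix.mulVec_zero, add_zero, pow_succ', Module.End.mul_apply, ← ih,
          Matrix.mulVecLin_apply]
    refine ⟨x 0, ?_⟩
    funext t
    have := (hx t).2
    rw [hin, hout, Matrix.mulVec_zero, add_zero, hxt] at this
    rw [freeResponse_apply, this]

/-- The dimension of the space of free responses is at most the McMillan degree. -/
theorem finrank_quotient_ker_freeResponse_le (S : LTISystem nx nu ny) :
    Module.finrank ℝ ((Fin nx → ℝ) ⧸ LinearMap.ker S.freeResponse) ≤ S.mcMillanDegree := by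
  refine le_csInf ⟨nx, S, rfl⟩ ?_
  rintro m ⟨S', hS'⟩
  have hS' : S'.behavior = S.behavior := hS'
  have h : LinearMap.range S.freeResponse = LinearMap.range S'.freeResponse := by
    ext y
    rw [mem_range_freeResponse, mem_range_freeResponse, hS']
  rw [S.freeResponse.quotKerEquivRange.finrank_eq, h]
  simpa using LinearMap.finrank_range_le S'.freeResponse

theorem ker_freeResponse_le_comap (S : LTISystem nx nu ny) :
    LinearMap.ker S.freeResponse ≤ (LinearMap.ker S.freeResponse).comap S.A.mulVecLin := by
  intro x hx
  rw [Submodule.mem_comap, LinearMap.mem_ker]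
  funext t
  have := congrFun (LinearMap.mem_ker.1 hx) (t + 1)
  rw [freeResponse_apply, pow_succ, Module.End.mul_apply] at this
  exact this

/-- Along any trajectory from `0`, every `ξ Aⁱ` stays zero, and such trajectories reach every state.
-/
theorem Controllable.eq_zero_of_forall_markov {S : LTISystem nx nu ny} (hS : S.Controllable)
    (ξ : (Fin nx → ℝ) →ₗ[ℝ] ℝ)
    (hξ : ∀ i v, ξ ((S.A.mulVecLin ^ i) (S.B.mulVec v)) = 0) : ξ = 0 := by
  refine LinearMap.ext fun x₁ => ?_
  obtain ⟨T, u, x, h0, hT, hx⟩ := hS 0 x₁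
  have key : ∀ t ≤ T, ∀ i, ξ ((S.A.mulVecLin ^ i) (x t)) = 0 := by
    intro t
    induction t with
    | zero => intro _ i; simp [h0]
    | succ t ih =>
      intro ht i
      rw [hx t (by omega), map_add, map_add, hξ, add_zero]
      have := ih (by omega) (i + 1)
      rwa [pow_succ, Module.End.mul_apply, Matrix.mulVecLin_apply] at this
  simpa [hT] using key T le_rfl 0

theorem Step.sum {S : LTISystem nx nu ny} {ι : Type*} [Fintype ι] {x x' : ι → Fin nx → ℝ}
    {w : ι → ExtIdx nu ny → ℝ} (h : ∀ j, S.Step (x j) (w j) (x' j)) (g : ι → ℝ) :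
    S.Step (∑ j, g j • x j) (∑ j, g j • w j) (∑ j, g j • x' j) := by
  have hin : inputPart (∑ j, g j • w j) = ∑ j, g j • inputPart (w j) := by
    funext i; simp [inputPart, Finset.sum_apply]
  have hout : outputPart (∑ j, g j • w j) = ∑ j, g j • outputPart (w j) := by
    funext i; simp [outputPart, Finset.sum_apply]
  simp only [Step, hin, hout, ← Matrix.mulVecLin_apply, map_sum, map_smul]
  simp only [← Finset.sum_add_distrib, ← smul_add, Matrix.mulVecLin_apply]
  exact ⟨Finset.sum_congr rfl fun j _ => by rw [(h j).1],
    Finset.sum_congr rfl fun j _ => by rw [(h j).2]⟩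

/-- Two trajectories with the same input whose initial states have the same free response
coincide. -/
theorem eq_of_step_of_freeResponse_eq {S : LTISystem nx nu ny} {L : ℕ}
    {x x' : ℕ → Fin nx → ℝ} {w w' : Fin L → ExtIdx nu ny → ℝ}
    (h : ∀ t : Fin L, S.Step (x t) (w t) (x (t + 1)))
    (h' : ∀ t : Fin L, S.Step (x' t) (w' t) (x' (t + 1)))
    (hw : ∀ t, inputPart (w t) = inputPart (w' t))
    (h0 : S.freeResponse (x 0) = S.freeResponse (x' 0)) : w = w' := by
  have hd : ∀ t ≤ L, x t - x' t = (S.A.mulVecLin ^ t) (x 0 - x' 0) := by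
    intro t
    induction t with
    | zero => simp
    | succ t ih =>
      intro ht
      rw [(h ⟨t, by omega⟩).1, (h' ⟨t, by omega⟩).1, hw, add_sub_add_right_eq_sub,
        ← Matrix.mulVec_sub, ih (by omega), pow_succ', Module.End.mul_apply,
        Matrix.mulVecLin_apply]
  funext t
  have hout : outputPart (w t) = outputPart (w' t) := by
    rw [(h t).2, (h' t).2, hw, add_left_inj, ← sub_eq_zero, ← Matrix.mulVec_sub, hd t (by omega),
      ← freeResponse_apply, map_sub, h0, sub_self]
    rfl
  funext i
  cases i with
  | inl i => exact congrFun (hw t) i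
  | inr i => exact congrFun hout i

end LTISystem

/-! ### The fundamental lemma -/

theorem hankelMap_apply {N L : ℕ} {ι : Type} (w : ℕ → ι → ℝ) (g : Fin (N + 1 - L) → ℝ)
    (t : Fin L) : hankelMap L (fun t : Fin N => w t) g t = ∑ j, g j • w (j + t) := by
  funext i
  simp [hankelMap, hankel, Matrix.mulVec, dotProduct, Finset.sum_apply, mul_comm,
    add_comm (t : ℕ)]

/-- Willems' fundamental lemma. -/
theorem LTISystem.Controllable.finiteBehavior_eq_range_hankelMap {nx nu ny : ℕ}
    {S : LTISystem nx nu ny} (hS : S.Controllable) {L N : ℕ} {wd : Signal N (ExtIdx nu ny)}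
    (hwd : wd ∈ S.finiteBehavior N) {n : ℕ} (hn : S.mcMillanDegree ≤ n)
    (hu : PersistentlyExciting (fun t => inputPart (wd t)) (L + n)) :
    S.finiteBehavior L = Set.range (hankelMap L wd) := by
  obtain ⟨xf, hxf⟩ := hwd
  -- Extension by zero to `ℕ` frees the index arithmetic from bounds; the system equations are used
  -- only below `N`.
  obtain ⟨x, rfl⟩ : ∃ x : ℕ → Fin nx → ℝ, xf = fun t : Fin (N + 1) => x t :=
    ⟨fun t => if h : t < N + 1 then xf ⟨t, h⟩ else 0, by funext t; beta_reduce; rw [dif_pos t.isLt]⟩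
  obtain ⟨w, rfl⟩ : ∃ w : ℕ → ExtIdx nu ny → ℝ, wd = fun t : Fin N => w t :=
    ⟨fun t => if h : t < N then wd ⟨t, h⟩ else 0, by funext t; simp⟩
  have hx : ∀ t < N, S.Step (x t) (w t) (x (t + 1)) := fun t ht => hxf ⟨t, ht⟩
  have hstep : ∀ (g : Fin (N + 1 - L) → ℝ) (t : Fin L),
      S.Step (∑ j, g j • x (j + t)) (hankelMap L (fun t : Fin N => w t) g t)
        (∑ j, g j • x (j + (t + 1))) := fun g t => by
    rw [hankelMap_apply]
    exact LTISystem.Step.sum (fun j => hx _ (by omega)) g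
  apply Set.Subset.antisymm
  · rintro v ⟨zf, hz⟩
    obtain ⟨z, rfl⟩ : ∃ z : ℕ → Fin nx → ℝ, zf = fun t : Fin (L + 1) => z t :=
      ⟨fun t => if h : t < L + 1 then zf ⟨t, h⟩ else 0, by funext t; beta_reduce; rw [dif_pos t.isLt]⟩
    let K := LinearMap.ker S.freeResponse
    let a : Module.End ℝ ((Fin nx → ℝ) ⧸ K) :=
      K.mapQ K S.A.mulVecLin S.ker_freeResponse_le_comap
    have ha : ∀ (i : ℕ) y, (a ^ i) (K.mkQ y) = K.mkQ ((S.A.mulVecLin ^ i) y) := by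
      intro i y
      induction i with
      | zero => simp
      | succ i ih =>
        rw [pow_succ', Module.End.mul_apply, ih, pow_succ', Module.End.mul_apply]
        rfl
    obtain ⟨g, hg0, hg⟩ := exists_hankel_combination a L (K.mkQ ∘ₗ S.B.mulVecLin)
      (N := N) (u := fun t => inputPart (w t)) (x := fun t => K.mkQ (x t)) (n := n)
      (fun ξ hξ => by
        have h := hS.eq_zero_of_forall_markov (ξ ∘ₗ K.mkQ) fun i v => by
          have := congrFun (congrArg DFunLike.coe (hξ i)) v
          simpa only [LinearMap.comp_apply, ha, Matrix.mulVecLin_apply, LinearMap.zero_apply]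
            using this
        exact (LinearMap.cancel_right K.mkQ_surjective).1 (by rw [h, LinearMap.zero_comp]))
      (fun t ht => by
        rw [(hx t ht).1, map_add]
        rfl)
      (S.finrank_quotient_ker_freeResponse_le.trans hn) hu (K.mkQ (z 0))
      (fun t => inputPart (v t))
    refine ⟨g, ?_⟩
    refine LTISystem.eq_of_step_of_freeResponse_eq (S := S) (x := fun t => ∑ j, g j • x (j + t))
      (x' := z) (hstep g) (fun t => hz t) (fun t => ?_) ?_
    · rw [← hg t, hankelMap_apply]
      funext i
      simp [inputPart, Finset.sum_apply]
    -- The initial states agree only modulo `K`, which is exactly equality of their free responses.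
    · have : K.mkQ (∑ j, g j • x j) = K.mkQ (z 0) := by
        rw [← hg0]
        simp only [map_sum, map_smul]
      rw [Submodule.mkQ_apply, Submodule.mkQ_apply, Submodule.Quotient.eq, LinearMap.mem_ker,
        map_sub, sub_eq_zero] at this
      simpa using this
  · rintro _ ⟨g, rfl⟩
    exact ⟨fun t => ∑ j, g j • x (j + t), fun t => by simpa using hstep g t⟩

/-! ### Lifting measures through a linear map -/

/-- The probability measures supported on the range of a linear map between finite-dimensional
spaces are the push-forwards of probability measures. -/
theorem LinearMap.isProbabilityMeasure_range_eq_one_iff {E F : Type*}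
    [AddCommGroup E] [Module ℝ E] [TopologicalSpace E] [IsTopologicalAddGroup E]
    [ContinuousSMul ℝ E] [T2Space E] [FiniteDimensional ℝ E] [MeasurableSpace E] [BorelSpace E]
    [AddCommGroup F] [Module ℝ F] [TopologicalSpace F] [IsTopologicalAddGroup F]
    [ContinuousSMul ℝ F] [T2Space F] [FiniteDimensional ℝ F] [MeasurableSpace F] [BorelSpace F]
    (f : E →ₗ[ℝ] F) (μ : Measure F) :
    (IsProbabilityMeasure μ ∧ μ (Set.range f) = 1) ↔
      ∃ ν : Measure E, IsProbabilityMeasure ν ∧ μ = ν.map f := by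
  have hf : Measurable f := f.continuous_of_finiteDimensional.measurable
  have hr : MeasurableSet (Set.range f) := by
    rw [← LinearMap.coe_range]
    exact (Submodule.closed_of_finiteDimensional (LinearMap.range f)).measurableSet
  constructor
  · rintro ⟨hμ, h1⟩
    obtain ⟨s, hs⟩ := f.rangeRestrict.exists_rightInverse_of_surjective f.range_rangeRestrict
    obtain ⟨g, hg⟩ : ∃ g : F →ₗ[ℝ] E, g ∘ₗ (LinearMap.range f).subtype = s :=
      -- Extending the section linearly to all of `F` makes it measurable; `f ∘ g = id` holds on the
      -- range, hence `μ`-almost everywhere.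
      LinearMap.exists_extend s
    have hgm : Measurable g := g.continuous_of_finiteDimensional.measurable
    refine ⟨μ.map g, Measure.isProbabilityMeasure_map hgm.aemeasurable, ?_⟩
    rw [Measure.map_map hf hgm]
    have hae : (fun y : F => f (g y)) =ᵐ[μ] fun y => y := by
      have : ∀ᵐ y ∂μ, y ∈ Set.range f := by
        rw [← prob_compl_eq_zero_iff hr] at h1
        exact h1
      filter_upwards [this] with y hy
      have h2 : g y = s ⟨y, hy⟩ := congrFun (congrArg DFunLike.coe hg) ⟨y, hy⟩
      have h3 : f.rangeRestrict (s ⟨y, hy⟩) = ⟨y, hy⟩ :=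
        congrFun (congrArg DFunLike.coe hs) ⟨y, hy⟩
      rw [h2]
      exact congrArg Subtype.val h3
    exact ((Measure.map_congr hae).trans Measure.map_id).symm
  · rintro ⟨ν, hν, rfl⟩
    refine ⟨Measure.isProbabilityMeasure_map hf.aemeasurable, ?_⟩
    rw [Measure.map_apply hf hr]
    simp

theorem mainTheorem1 {nx nu ny : ℕ} (S : LTISystem nx nu ny) (hS : S.Controllable)
    (L N : ℕ) (wd : Signal N (ExtIdx nu ny)) (hwd : wd ∈ S.finiteBehavior N) :
    (∀ nbar : ℕ, S.mcMillanDegree ≤ nbar →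
      PersistentlyExciting (fun t => inputPart (wd t)) (L + nbar) →
      S.behavioralMeasures L =
        {μ | ∃ ν : Measure (Fin (N + 1 - L) → ℝ),
          IsProbabilityMeasure ν ∧ μ = ν.map (hankelMap L wd)}) ∧
    (∀ (mx : ℕ) (S' : LTISystem mx nu ny), S'.Realizes S → S.mcMillanDegree ≤ mx) := by
  refine ⟨fun nbar hn hu => ?_, fun mx S' h => Nat.sInf_le ⟨S', h⟩⟩
  let f : (Fin (N + 1 - L) → ℝ) →ₗ[ℝ] Signal L (ExtIdx nu ny) :=
    LinearMap.pi fun t => LinearMap.pi fun i =>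
      LinearMap.proj (t, i) ∘ₗ (hankel L wd).mulVecLin
  have hf : hankelMap L wd = f := rfl
  ext μ
  rw [LTISystem.behavioralMeasures, Set.mem_ofPred_eq, Set.mem_ofPred_eq,
    hS.finiteBehavior_eq_range_hankelMap hwd hn hu, hf]
  exact f.isProbabilityMeasure_range_eq_one_iff μ
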